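/- The machine model is the random access machine with addition, truncated subtraction, multiplication, integer division, and direct and indirect access to memory cells holding natural numbers, under the logarithmic cost criterion (each instruction or test costs one plus the binary lengths of the numbers it handles and of the memory address it uses). For $d\ge 1$, an instance of #$d$-SAT is a number $n$ of Boolean variables together with a finite set of clauses over these variables, each a sequence of $d$ literals (repetitions of a literal in a clause are allowed, so that clauses with fewer than $d$ distinct literals are covered); the task is to compute the number of satisfying truth assignments of the $n$ variables. The Counting Strong Exponential-Time Hypothesis (#SETH) states that for every $\epsilon>0$ there is an integer $d\ge 1$ such that $n$-variable #$d$-SAT cannot be solved in time $\mathcal{O}((2-\epsilon)^n)$. For integers $q,r\ge 2$, an instance of #CSP$(q,r)$ consists of $n$ variables and a list of $m$ constraints, each given by a tuple of at most $r$ variables (not necessarily distinct) and a relation of the same arity over the domain $[q]$, given by its truth table; the task is to compute the number of valuations of the $n$ variables in $[q]$ that satisfy all constraints. **Theorem.** For every integer $q\ge 2$ and every real $\epsilon>0$ there is an integer $r\ge 2$ such that the following holds. Unless the #SETH fails, #CSP$(q,r)$ with $n$ variables and $m$ constraints cannot be solved in time $(q-\epsilon)^n\cdot(n+m)^{\mathcal{O}(1)}$,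 that is, there are no constants $C,k$ and no algorithm that solves every instance in time at most $C\,(q-\epsilon)^n\,(n+m+1)^k$. -/

import Mathlib

/-! ### Random access machines with logarithmic cost -/

namespace RAM

/-- Programs of a random access machine, with structured control flow. A program works on
registers `0, 1, 2, …` (of which it mentions finitely many) and on a memory whose cells have the
addresses `0, 1, 2, …`; every register and every cell holds a natural number. -/
inductive Prog : Type
  /-- do nothing -/
  | skip
  /-- `x := c` -/
  | const (x c : ℕ)
  /-- `x := y + z` -/
  | add (x y z : ℕ)
  /-- `x := max (y - z) 0` -/
  | sub (x y z : ℕ)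
  /-- `x := y * z` -/
  | mul (x y z : ℕ)
  /-- `x := ⌊y / z⌋` (and `0` if `z = 0`) -/
  | div (x y z : ℕ)
  /-- `x := mem[y]` -/
  | load (x y : ℕ)
  /-- `mem[x] := y` -/
  | store (x y : ℕ)
  /-- first `p`, then `p'` -/
  | seq (p p' : Prog)
  /-- if `x ≠ 0` then `p` else `p'` -/
  | ite (x : ℕ) (p p' : Prog)
  /-- while `x ≠ 0` do `p` -/
  | loop (x : ℕ) (p : Prog)

/-- The contents of the registers and of the memory. -/
structure State : Type where
  reg : ℕ → ℕ
  mem : ℕ → ℕ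

/-- Write `v` to register `x`. -/
def State.setReg (s : State) (x v : ℕ) : State :=
  { s with reg := Function.update s.reg x v }

/-- Write `v` to the memory cell with address `a`. -/
def State.setMem (s : State) (a v : ℕ) : State :=
  { s with mem := Function.update s.mem a v }

/-- The initial state on an input: the input stands in the first memory cells, everything else
is `0`. -/
def State.init (input : List ℕ) : State where
  reg _ := 0
  mem i := input.getD i 0

/-- `Exec p s s' t`: started in the state `s`, the program `p` halts in the state `s'`, and the
run takes time `t`. The time is the logarithmic cost: every instruction and every test costs one
plus the lengths in binary (`Nat.size`) of the numbers it reads, and of the memory address that it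
uses, if any. -/
inductive Exec : Prog → State → State → ℕ → Prop
  | skip (s : State) : Exec .skip s s 1
  | const (s : State) (x c : ℕ) :
      Exec (.const x c) s (s.setReg x c) (1 + Nat.size c)
  | add (s : State) (x y z : ℕ) :
      Exec (.add x y z) s (s.setReg x (s.reg y + s.reg z))
        (1 + Nat.size (s.reg y) + Nat.size (s.reg z))
  | sub (s : State) (x y z : ℕ) :
      Exec (.sub x y z) s (s.setReg x (s.reg y - s.reg z))
        (1 + Nat.size (s.reg y) + Nat.size (s.reg z))
  | mul (s : State) (x y z : ℕ) :
      Exec (.mul x y z) s (s.setReg x (s.reg y * s.reg z))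
        (1 + Nat.size (s.reg y) + Nat.size (s.reg z))
  | div (s : State) (x y z : ℕ) :
      Exec (.div x y z) s (s.setReg x (s.reg y / s.reg z))
        (1 + Nat.size (s.reg y) + Nat.size (s.reg z))
  | load (s : State) (x y : ℕ) :
      Exec (.load x y) s (s.setReg x (s.mem (s.reg y)))
        (1 + Nat.size (s.reg y) + Nat.size (s.mem (s.reg y)))
  | store (s : State) (x y : ℕ) :
      Exec (.store x y) s (s.setMem (s.reg x) (s.reg y))
        (1 + Nat.size (s.reg x) + Nat.size (s.reg y))
  | seq {p p' : Prog} {s s' s'' : State} {t t' : ℕ}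
      (h : Exec p s s' t) (h' : Exec p' s' s'' t') : Exec (.seq p p') s s'' (t + t')
  | ite_true {x : ℕ} {p p' : Prog} {s s' : State} {t : ℕ} (hx : s.reg x ≠ 0)
      (h : Exec p s s' t) : Exec (.ite x p p') s s' (1 + Nat.size (s.reg x) + t)
  | ite_false {x : ℕ} {p p' : Prog} {s s' : State} {t : ℕ} (hx : s.reg x = 0)
      (h : Exec p' s s' t) : Exec (.ite x p p') s s' (1 + Nat.size (s.reg x) + t)
  | loop_true {x : ℕ} {p : Prog} {s s' s'' : State} {t t' : ℕ} (hx : s.reg x ≠ 0)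
      (h : Exec p s s' t) (h' : Exec (.loop x p) s' s'' t') :
      Exec (.loop x p) s s'' (1 + Nat.size (s.reg x) + t + t')
  | loop_false {x : ℕ} {p : Prog} {s : State} (hx : s.reg x = 0) :
      Exec (.loop x p) s s (1 + Nat.size (s.reg x))

/-- The problem of computing `f I` from the instance `I`, presented to the machine as `enc I`, can
be solved in time `T`: some program halts on every instance `I` after time at most `T I`, with
`f I` in register `0`. -/
def SolvableInTime {ι : Type} (enc : ι → List ℕ) (f : ι → ℕ) (T : ι → ℝ) : Prop :=
  ∃ P : Prog, ∀ I : ι, ∃ (s : State) (t : ℕ),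
    Exec P (State.init (enc I)) s t ∧ s.reg 0 = f I ∧ (t : ℝ) ≤ T I

end RAM

/-! ### Counting satisfying assignments of `d`-CNF formulas -/

/-- An instance of `#d`-SAT: a number `n` of Boolean variables and a collection of pairwise
different clauses, each of which has `d` literals. The literal `(x, b)` is `x` if `b = true` and
`¬ x` if `b = false`. -/
structure CNF (d : ℕ) : Type where
  n : ℕ
  clauses : List (Fin d → Fin n × Bool)
  nodup : clauses.Nodup

namespace CNF

variable {d : ℕ}

/-- The truth assignment `a` satisfies every clause. -/
def Satisfies (φ : CNF d) (a : Fin φ.n → Bool) : Prop :=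
  ∀ c ∈ φ.clauses, ∃ j, a (c j).1 = (c j).2

/-- The number of satisfying assignments. -/
noncomputable def count (φ : CNF d) : ℕ := Nat.card {a : Fin φ.n → Bool // φ.Satisfies a}

/-- The number of variables, the number of clauses, and then clause by clause and literal by
literal the variable and the sign. -/
def encode (φ : CNF d) : List ℕ :=
  φ.n :: φ.clauses.length ::
    φ.clauses.flatMap fun c =>
      (List.ofFn c).flatMap fun l => [(l.1 : ℕ), if l.2 then 1 else 0]

end CNF

/-- The Counting Strong Exponential-Time Hypothesis: for every `ε > 0` there is `d ≥ 1` such that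
`n`-variable `#d`-SAT cannot be solved in time `O((2 - ε) ^ n)`. -/
def SharpSETH : Prop :=
  ∀ ε : ℝ, 0 < ε → ∃ d : ℕ, 1 ≤ d ∧
    ¬ ∃ C : ℝ, RAM.SolvableInTime (CNF.encode (d := d)) CNF.count
      fun φ => C * (2 - ε) ^ φ.n

/-! ### Counting solutions of constraint satisfaction problems -/

/-- A constraint of arity at most `r` on `n` variables with a domain of size `q`: a tuple of
variables, and the relation that their values have to satisfy. -/
structure Constraint (q r n : ℕ) : Type where
  arity : ℕ
  arity_le : arity ≤ r
  scope : Fin arity → Fin n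
  rel : Finset (Fin arity → Fin q)

/-- The arity, the scope, and the truth table of the relation, which has `q ^ arity` entries. -/
def Constraint.encode {q r n : ℕ} (c : Constraint q r n) : List ℕ :=
  c.arity :: (List.ofFn fun i => (c.scope i : ℕ)) ++
    List.ofFn fun j : Fin (q ^ c.arity) => if finFunctionFinEquiv.symm j ∈ c.rel then 1 else 0

/-- An instance of `CSP(q, r)`: a number `n` of variables and a list of constraints of arity at
most `r` over the domain `Fin q`. -/
structure CSP (q r : ℕ) : Type where
  n : ℕ
  constraints : List (Constraint q r n)

namespace CSP

variable {q r : ℕ}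

/-- The number of constraints. -/
def m (Ψ : CSP q r) : ℕ := Ψ.constraints.length

/-- The valuation `v` satisfies every constraint. -/
def Satisfies (Ψ : CSP q r) (v : Fin Ψ.n → Fin q) : Prop :=
  ∀ c ∈ Ψ.constraints, (fun i => v (c.scope i)) ∈ c.rel

/-- The number of satisfying valuations. -/
noncomputable def count (Ψ : CSP q r) : ℕ := Nat.card {v : Fin Ψ.n → Fin q // Ψ.Satisfies v}

/-- The number of variables, the number of constraints, and then the constraints. -/
def encode (Ψ : CSP q r) : List ℕ :=
  Ψ.n :: Ψ.m :: Ψ.constraints.flatMap Constraint.encode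

end CSP

/-- `#CSP(q, r)` with `n` variables and `m` constraints can be solved in time
`b ^ n * (n + m) ^ O(1)`. The polynomial factor is written `C * (n + m + 1) ^ k`, so that it does
not vanish on the empty instance. -/
def SharpCSPSolvable (q r : ℕ) (b : ℝ) : Prop :=
  ∃ (C : ℝ) (k : ℕ), RAM.SolvableInTime (CSP.encode (q := q) (r := r)) CSP.count
    fun Ψ => b ^ Ψ.n * (C * ((Ψ.n : ℝ) + (Ψ.m : ℝ) + 1) ^ k)

/-!
Suppose that `#CSP(q, r)` could be solved with base `q - ε` for every `r`. Choose `a` and `b` such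
that `a` variables over `Fin q` have at least `2 ^ b` values and `max (q - ε) 1 ^ a < 2 ^ b`
(`exists_block_sizes`). A `d`-CNF formula is translated into a constraint satisfaction problem by
cutting its Boolean variables into blocks of `b`, and representing a block by `a` variables over
`Fin q`, read as a number in base `q` whose binary digits are the values of the Boolean variables.
One constraint per block confines this number to the digits that belong to Boolean variables, so
that every truth assignment is represented exactly once; a clause becomes a constraint on the `d`
blocks in which its variables lie. So the number of solutions is kept (`CNF.count_toCSP`), the arity
is at most `d * a`, and there are `(n / b + 1) * a` variables. Translating a formula and then solving
the translation takes time `O(γ' ^ n)` for some `γ' < 2` that does not depend on `d`, because the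
number of clauses is polynomial in `n` (`CNF.solvableInTime_of_sharpCSPSolvable`). This contradicts
the Counting Strong Exponential-Time Hypothesis for `2 - γ'`.

The translation has to be carried out by a random access machine in polynomial time
(`CNF.exists_prog_toCSP`). The program uses register `0` as a loop counter and otherwise only
temporary registers. In each round it computes a block of a fixed number of values from the counter
and the memory (`RAM.Evaluable`), and writes it (`RAM.exists_takes_writeBlock`). Such a round takes
time linear in the maximal length of the numbers involved, so that it remains to count the rounds
(`RAM.takes_countdown`). The new instance is written over the old one: the constraint of a
clause is longer than the clause, so the clauses can be replaced from the last to the first, and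
nothing of the input is left over.
-/

/-! ### Programs for straight-line code and counted loops -/

namespace RAM

theorem Exec.one_le {p : Prog} {s s' : State} {t : ℕ} (h : Exec p s s' t) : 1 ≤ t := by
  induction h <;> omega

/-- A bound on the registers that the program writes: they are all smaller. -/
def Prog.bound : Prog → ℕ
  | skip => 0
  | const x _ => x + 1
  | add x _ _ => x + 1
  | sub x _ _ => x + 1
  | mul x _ _ => x + 1
  | div x _ _ => x + 1
  | load x _ => x + 1
  | store _ _ => 0
  | seq p p' => max p.bound p'.bound
  | ite _ p p' => max p.bound p'.bound
  | loop _ p => p.bound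

theorem Exec.reg_eq_of_bound_le {p : Prog} {s s' : State} {t : ℕ} (h : Exec p s s' t) {x : ℕ}
    (hx : p.bound ≤ x) : s'.reg x = s.reg x := by
  induction h with
  | skip | store | loop_false => rfl
  | const | add | sub | mul | div | load =>
    simp only [Prog.bound] at hx
    simp only [State.setReg]
    exact Function.update_of_ne (by omega) _ _
  | seq _ _ ih ih' =>
    simp only [Prog.bound, max_le_iff] at hx
    rw [ih' hx.2, ih hx.1]
  | ite_true _ _ ih =>
    simp only [Prog.bound, max_le_iff] at hx
    exact ih hx.1
  | ite_false _ _ ih =>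
    simp only [Prog.bound, max_le_iff] at hx
    exact ih hx.2
  | loop_true _ _ _ ih ih' => rw [ih' hx, ih hx]

/-- The program that sets the registers below `n` to `0`. -/
def clear : ℕ → Prog
  | 0 => .skip
  | n + 1 => .seq (clear n) (.const n 0)

theorem exec_clear (n : ℕ) (s : State) :
    Exec (clear n) s ⟨fun x => if x < n then 0 else s.reg x, s.mem⟩ (n + 1) := by
  induction n with
  | zero => exact Exec.skip s
  | succ n ih =>
    change Exec (.seq (clear n) (.const n 0)) _ _ _
    convert Exec.seq ih (Exec.const _ n 0) using 1
    · refine congrArg (fun r => State.mk r s.mem) (funext fun x => ?_)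
      rcases eq_or_ne x n with rfl | h
      · simp
      · rw [Function.update_of_ne h]
        grind
    · rw [Nat.size_zero]

/-- The loop counter `c` and all cells of the memory `M` have at most `W` binary digits. -/
def Bounded (W c : ℕ) (M : ℕ → ℕ) : Prop :=
  c.size ≤ W ∧ ∀ y, (M y).size ≤ W

/-- The number `e c M`, where `c` is the content of register `0` and `M` the memory, can be
computed into any register `x > 0`, without a change of the memory or of the registers below `x`,
in time linear in the maximal length of the numbers in `c` and `M`. -/
def Evaluable (e : ℕ → (ℕ → ℕ) → ℕ) : Prop :=
  ∃ K, (∀ W c M, Bounded W c M → (e c M).size ≤ K * (W + 1)) ∧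
    ∀ x, 0 < x → ∃ p, ∀ s : State, ∃ s' t, Exec p s s' t ∧ s'.mem = s.mem ∧
      s'.reg x = e (s.reg 0) s.mem ∧ (∀ y < x, s'.reg y = s.reg y) ∧
      ∀ W, Bounded W (s.reg 0) s.mem → t ≤ K * (W + 1)

namespace Evaluable

variable {e e₁ e₂ : ℕ → (ℕ → ℕ) → ℕ}

theorem const (k : ℕ) : Evaluable fun _ _ => k := by
  refine ⟨k.size + 1, fun W _ _ _ => by nlinarith, fun x hx => ⟨.const x k, fun s =>
    ⟨_, _, .const s x k, rfl, ?_, fun y hy => ?_, fun W _ => by nlinarith⟩⟩⟩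
  · simp [State.setReg]
  · simp [State.setReg, hy.ne]

theorem binary {op : ℕ → ℕ → ℕ} (instr : ℕ → ℕ → ℕ → Prog)
    (hinstr : ∀ s x y z, Exec (instr x y z) s (s.setReg x (op (s.reg y) (s.reg z)))
      (1 + Nat.size (s.reg y) + Nat.size (s.reg z)))
    (hop : ∀ u v, (op u v).size ≤ u.size + v.size + 1)
    (h₁ : Evaluable e₁) (h₂ : Evaluable e₂) : Evaluable fun c M => op (e₁ c M) (e₂ c M) := by
  obtain ⟨K₁, hK₁, h₁⟩ := h₁
  obtain ⟨K₂, hK₂, h₂⟩ := h₂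
  refine ⟨2 * (K₁ + K₂) + 1, fun W c M hW => ?_, fun x hx => ?_⟩
  · have := hop (e₁ c M) (e₂ c M)
    have := hK₁ W c M hW
    have := hK₂ W c M hW
    nlinarith
  · obtain ⟨p₁, hp₁⟩ := h₁ x hx
    obtain ⟨p₂, hp₂⟩ := h₂ (x + 1) x.succ_pos
    refine ⟨.seq p₁ (.seq p₂ (instr x x (x + 1))), fun s => ?_⟩
    obtain ⟨s₁, t₁, hs₁, hm₁, hx₁, hr₁, ht₁⟩ := hp₁ s
    obtain ⟨s₂, t₂, hs₂, hm₂, hx₂, hr₂, ht₂⟩ := hp₂ s₁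
    rw [hr₁ 0 hx, hm₁] at hx₂ ht₂
    have hxx : s₂.reg x = e₁ (s.reg 0) s.mem := by rw [hr₂ x x.lt_succ_self, hx₁]
    refine ⟨_, _, hs₁.seq (hs₂.seq (hinstr _ _ _ _)), ?_, ?_, fun y hy => ?_, fun W hW => ?_⟩
    · simp [State.setReg, hm₂, hm₁]
    · simp [State.setReg, hxx, hx₂]
    · simp only [State.setReg, Function.update_of_ne hy.ne]
      rw [hr₂ y (by omega), hr₁ y hy]
    · rw [hxx, hx₂]
      have := hK₁ W _ _ hW
      have := hK₂ W _ _ hW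
      have := ht₁ W hW
      have := ht₂ W hW
      nlinarith

theorem add (h₁ : Evaluable e₁) (h₂ : Evaluable e₂) :
    Evaluable fun c M => e₁ c M + e₂ c M := by
  refine binary .add Exec.add (fun u v => Nat.size_le.2 ?_) h₁ h₂
  have hu := u.lt_size_self
  have hv := v.lt_size_self
  have h₁ : 2 ^ u.size ≤ 2 ^ (u.size + v.size) := Nat.pow_le_pow_right two_pos (by omega)
  have h₂ : 2 ^ v.size ≤ 2 ^ (u.size + v.size) := Nat.pow_le_pow_right two_pos (by omega)
  rw [pow_succ]
  omega

theorem sub (h₁ : Evaluable e₁) (h₂ : Evaluable e₂) :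
    Evaluable fun c M => e₁ c M - e₂ c M :=
  binary .sub Exec.sub (fun u v => (Nat.size_le_size (Nat.sub_le u v)).trans (by omega)) h₁ h₂

theorem mul (h₁ : Evaluable e₁) (h₂ : Evaluable e₂) :
    Evaluable fun c M => e₁ c M * e₂ c M := by
  refine binary .mul Exec.mul (fun u v => Nat.size_le.2 ?_) h₁ h₂
  calc u * v < 2 ^ u.size * 2 ^ v.size :=
        Nat.mul_lt_mul'' u.lt_size_self v.lt_size_self
    _ = 2 ^ (u.size + v.size) := (pow_add ..).symm
    _ ≤ _ := Nat.pow_le_pow_right two_pos (by omega)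

theorem div (h₁ : Evaluable e₁) (h₂ : Evaluable e₂) :
    Evaluable fun c M => e₁ c M / e₂ c M :=
  binary .div Exec.div (fun u v => (Nat.size_le_size (Nat.div_le_self u v)).trans (by omega)) h₁ h₂

theorem mod (h₁ : Evaluable e₁) (h₂ : Evaluable e₂) :
    Evaluable fun c M => e₁ c M % e₂ c M := by
  simpa only [Nat.mod_eq_sub] using h₁.sub (h₂.mul (h₁.div h₂))

/-- The machine has no instruction that copies a register, hence the addition of `0`. -/
theorem counter : Evaluable fun c _ => c := by
  refine ⟨3, fun W c M hW => hW.1.trans (by omega), fun x hx =>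
    ⟨.seq (.const x 0) (.add x 0 x), fun s => ?_⟩⟩
  refine ⟨_, _, (Exec.const s x 0).seq (Exec.add _ x 0 x), rfl, ?_, fun y hy => ?_,
    fun W hW => ?_⟩
  · simp [State.setReg, hx.ne]
  · simp [State.setReg, hy.ne]
  · have := hW.1
    simp only [State.setReg, Function.update_of_ne hx.ne, Function.update_self, Nat.size_zero]
    omega

theorem load (h : Evaluable e) : Evaluable fun c M => M (e c M) := by
  obtain ⟨K, hK, h⟩ := h
  refine ⟨2 * K + 1, fun W c M hW => by have := hW.2 (e c M); nlinarith, fun x hx => ?_⟩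
  obtain ⟨p, hp⟩ := h x hx
  refine ⟨.seq p (.load x x), fun s => ?_⟩
  obtain ⟨s₁, t₁, hs₁, hm₁, hx₁, hr₁, ht₁⟩ := hp s
  refine ⟨_, _, hs₁.seq (.load s₁ x x), hm₁, ?_, fun y hy => ?_, fun W hW => ?_⟩
  · simp [State.setReg, hx₁, hm₁]
  · simp [State.setReg, hy.ne, hr₁ y hy]
  · rw [hx₁, hm₁]
    have := hK W _ _ hW
    have := ht₁ W hW
    have := hW.2 (e (s.reg 0) s.mem)
    nlinarith

theorem sum {ι : Type*} (S : Finset ι) {f : ι → ℕ → (ℕ → ℕ) → ℕ} (h : ∀ i, Evaluable (f i)) :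
    Evaluable fun c M => ∑ i ∈ S, f i c M := by
  classical
  induction S using Finset.induction_on with
  | empty => simpa using const 0
  | insert i S hi ih => simpa only [Finset.sum_insert hi] using (h i).add ih

theorem prod {ι : Type*} (S : Finset ι) {f : ι → ℕ → (ℕ → ℕ) → ℕ} (h : ∀ i, Evaluable (f i)) :
    Evaluable fun c M => ∏ i ∈ S, f i c M := by
  classical
  induction S using Finset.induction_on with
  | empty => simpa using const 1
  | insert i S hi ih => simpa only [Finset.prod_insert hi] using (h i).mul ih

/-- The test `x = k` is `1 - ((x - k) + (k - x))` with truncated subtraction. -/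
theorem eq_const (h : Evaluable e) (k : ℕ) : Evaluable fun c M => if e c M = k then 1 else 0 := by
  convert (const 1).sub ((h.sub (const k)).add ((const k).sub h)) using 3 with c M
  split_ifs <;> omega

/-- Every function of boundedly many arguments below a fixed bound can be tabulated in the
program, whether or not a formula for it is at hand. -/
theorem table {ι : Type*} [Fintype ι] {f : ι → ℕ → (ℕ → ℕ) → ℕ} (h : ∀ i, Evaluable (f i))
    (D : ℕ) (g : (ι → ℕ) → ℕ) :
    Evaluable fun c M => if ∀ i, f i c M < D then g fun i => f i c M else 0 := by
  classical
  convert sum (Finset.univ : Finset (ι → Fin D)) fun u =>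
    (prod Finset.univ fun i => (h i).eq_const (u i)).mul (const (g fun i => u i)) using 3 with c M
  have hprod (u : ι → Fin D) : (∏ i, if f i c M = u i then 1 else 0) =
      if ∀ i, f i c M = u i then 1 else 0 := by
    rw [Finset.prod_ite_zero]
    simp
  simp only [hprod]
  split_ifs with hD
  · rw [Finset.sum_eq_single fun i => ⟨f i c M, hD i⟩]
    · simp
    · intro u _ hu
      rw [if_neg fun H => hu (funext fun i => Fin.ext (H i).symm), zero_mul]
    · simp
  · refine (Finset.sum_eq_zero fun u _ => ?_).symm
    rw [if_neg fun H : ∀ i, f i c M = u i => hD fun i => (H i).symm ▸ (u i).2, zero_mul]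

end Evaluable

/-- The memory `M` after the values `v 0, …, v (L - 1)` have been written to the cells from
`base` on. -/
def writeBlock (M : ℕ → ℕ) (base L : ℕ) (v : ℕ → ℕ) : ℕ → ℕ := fun y =>
  if base ≤ y ∧ y < base + L then v (y - base) else M y

/-- All values are computed before the first of them is written, so that a block may overwrite
the cells from which its values are computed. -/
theorem exists_exec_writeBlock {base : ℕ → (ℕ → ℕ) → ℕ} {v : ℕ → ℕ → (ℕ → ℕ) → ℕ}
    (hbase : Evaluable base) (hv : ∀ i, Evaluable (v i)) (L : ℕ) :
    ∃ K, ∀ x, 0 < x → ∃ p, ∀ s : State, ∃ s' t, Exec p s s' t ∧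
      s'.mem = writeBlock s.mem (base (s.reg 0) s.mem) L (fun i => v i (s.reg 0) s.mem) ∧
      (∀ y < x, s'.reg y = s.reg y) ∧
      ∀ W, Bounded W (s.reg 0) s.mem → t ≤ K * (W + 1) := by
  induction L with
  | zero =>
    refine ⟨1, fun x _ => ⟨.skip, fun s => ⟨s, 1, .skip s, ?_, fun _ _ => rfl, fun W _ => ?_⟩⟩⟩
    · funext y
      simp [writeBlock]
    · omega
  | succ L ih =>
    obtain ⟨K, ih⟩ := ih
    obtain ⟨K₁, hK₁, h₁⟩ := hv L
    obtain ⟨K₂, hK₂, h₂⟩ := hbase.add (.const L)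
    refine ⟨K + 2 * (K₁ + K₂) + 1, fun x hx => ?_⟩
    obtain ⟨p₁, hp₁⟩ := h₁ x hx
    obtain ⟨p₂, hp₂⟩ := h₂ (x + 1) x.succ_pos
    obtain ⟨p, hp⟩ := ih (x + 2) (by omega)
    refine ⟨.seq p₁ (.seq p₂ (.seq p (.store (x + 1) x))), fun s => ?_⟩
    obtain ⟨s₁, t₁, hs₁, hm₁, hx₁, hr₁, ht₁⟩ := hp₁ s
    obtain ⟨s₂, t₂, hs₂, hm₂, hx₂, hr₂, ht₂⟩ := hp₂ s₁
    obtain ⟨s₃, t₃, hs₃, hm₃, hr₃, ht₃⟩ := hp s₂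
    rw [hr₁ 0 hx, hm₁] at hx₂ ht₂
    rw [hr₂ 0 (by omega), hr₁ 0 hx, hm₂, hm₁] at hm₃ ht₃
    have hxx : s₃.reg x = v L (s.reg 0) s.mem := by
      rw [hr₃ x (by omega), hr₂ x (by omega), hx₁]
    have hxy : s₃.reg (x + 1) = base (s.reg 0) s.mem + L := by
      rw [hr₃ (x + 1) (by omega), hx₂]
    refine ⟨_, _, hs₁.seq (hs₂.seq (hs₃.seq (.store s₃ (x + 1) x))), ?_, fun y hy => ?_,
      fun W hW => ?_⟩
    · simp only [State.setMem, hxx, hxy, hm₃]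
      funext y
      rcases eq_or_ne y (base (s.reg 0) s.mem + L) with rfl | hy
      · simp [writeBlock]
      · simp only [Function.update_of_ne hy, writeBlock]
        congr 1
        simp only [eq_iff_iff]
        omega
    · simp only [State.setMem]
      rw [hr₃ y (by omega), hr₂ y (by omega), hr₁ y hy]
    · rw [hxx, hxy]
      have := hK₁ W _ _ hW
      have := hK₂ W _ _ hW
      have := ht₁ W hW
      have := ht₂ W hW
      have := ht₃ W hW
      nlinarith

/-- Started with `c` in register `0` and the memory `M`, the program halts after time at most `T`
with `c'` in register `0` and the memory `M'`, whatever the other registers contain. -/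
def Takes (p : Prog) (c : ℕ) (M : ℕ → ℕ) (c' : ℕ) (M' : ℕ → ℕ) (T : ℕ) : Prop :=
  ∀ s : State, s.reg 0 = c → s.mem = M → ∃ s' t, Exec p s s' t ∧ s'.reg 0 = c' ∧ s'.mem = M' ∧
    t ≤ T

theorem Takes.seq {p p' : Prog} {c c' c'' : ℕ} {M M' M'' : ℕ → ℕ} {T T' : ℕ}
    (h : Takes p c M c' M' T) (h' : Takes p' c' M' c'' M'' T') :
    Takes (.seq p p') c M c'' M'' (T + T') := by
  intro s hc hM
  obtain ⟨s₁, t₁, hs₁, hc₁, hM₁, ht₁⟩ := h s hc hM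
  obtain ⟨s₂, t₂, hs₂, hc₂, hM₂, ht₂⟩ := h' s₁ hc₁ hM₁
  exact ⟨s₂, _, hs₁.seq hs₂, hc₂, hM₂, by omega⟩

theorem exists_takes_writeBlock {base : ℕ → (ℕ → ℕ) → ℕ} {v : ℕ → ℕ → (ℕ → ℕ) → ℕ}
    (hbase : Evaluable base) (hv : ∀ i, Evaluable (v i)) (L : ℕ) :
    ∃ p K, ∀ W c M, Bounded W c M →
      Takes p c M c (writeBlock M (base c M) L fun i => v i c M) (K * (W + 1)) := by
  obtain ⟨K, h⟩ := exists_exec_writeBlock hbase hv L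
  obtain ⟨p, hp⟩ := h 1 one_pos
  refine ⟨p, K, fun W c M hW s hc hM => ?_⟩
  subst hc hM
  obtain ⟨s', t, hs, hm, hr, ht⟩ := hp s
  exact ⟨s', t, hs, hr 0 one_pos, hm, ht W hW⟩

theorem exists_takes_setCounter {e : ℕ → (ℕ → ℕ) → ℕ} (he : Evaluable e) :
    ∃ p K, ∀ W c M, Bounded W c M → Takes p c M (e c M) M (K * (W + 1)) := by
  obtain ⟨K, hK, h⟩ := he
  obtain ⟨p, hp⟩ := h 1 one_pos
  refine ⟨.seq p (.seq (.const 0 0) (.add 0 1 0)), 2 * K + 2, fun W c M hW s hc hM => ?_⟩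
  subst hc hM
  obtain ⟨s', t, hs, hm, hx, hr, ht⟩ := hp s
  refine ⟨_, _, hs.seq ((Exec.const s' 0 0).seq (Exec.add _ 0 1 0)), ?_, ?_, ?_⟩
  · simp [State.setReg, hx]
  · simp [State.setReg, hm]
  · have := ht W hW
    have := hK W _ _ hW
    simp [State.setReg, hx]
    nlinarith

/-- The loop that counts register `0` down to `0`; the body finds the counter already decreased. -/
def countdown (p : Prog) : Prog :=
  .loop 0 (.seq (.const 1 1) (.seq (.sub 0 0 1) p))

theorem takes_countdown {p : Prog} {N T : ℕ} {M : ℕ → ℕ → ℕ}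
    (h : ∀ i < N, Takes p i (M (i + 1)) i (M i) T) :
    Takes (countdown p) N (M N) 0 (M 0) ((N + 1) * (T + 2 * N + 5)) := by
  have key : ∀ i ≤ N, Takes (countdown p) i (M i) 0 (M 0) ((i + 1) * (T + 2 * N + 5)) := by
    intro i
    induction i with
    | zero =>
      intro _ s hc hM
      refine ⟨s, _, .loop_false hc, hc, hM, ?_⟩
      simp only [hc, Nat.size_zero]
      omega
    | succ i ih =>
      intro hi s hc hM
      let s₁ : State := (s.setReg 1 1).setReg 0 i
      have h₁ : Exec (.sub 0 0 1) (s.setReg 1 1) s₁ (1 + (i + 1).size + 1) := by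
        convert Exec.sub (s.setReg 1 1) 0 0 1 using 1
        · simp [s₁, State.setReg, hc]
        · simp [State.setReg, hc]
      obtain ⟨s₂, t₂, hs₂, hc₂, hM₂, ht₂⟩ :=
        h i (by omega) s₁ (by simp [s₁, State.setReg]) (by simp [s₁, State.setReg, hM])
      obtain ⟨s₃, t₃, hs₃, hc₃, hM₃, ht₃⟩ := ih (by omega) s₂ hc₂ hM₂
      refine ⟨s₃, _, .loop_true (by omega) ((Exec.const s 1 1).seq (h₁.seq hs₂)) hs₃, hc₃, hM₃, ?_⟩
      have : (i + 1).size ≤ i + 1 := Nat.size_le.2 Nat.lt_two_pow_self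
      rw [hc, Nat.size_one]
      nlinarith
  exact key N le_rfl

end RAM

/-! ### The constraint satisfaction problem of a formula -/

section Reduction

variable {q a b d r : ℕ}

/-- The relation on `d` blocks of `a` values that holds if, for some `j`, the number with the
`q`-ary digits of block `j` has the binary digit `σ j` at position `p j`. -/
def clauseRel (q a : ℕ) (p : Fin d → ℕ) (σ : Fin d → Bool) : Finset (Fin (d * a) → Fin q) :=
  Finset.univ.filter fun f => ∃ j,
    (finFunctionFinEquiv fun i => f (finProdFinEquiv (j, i)) : ℕ).testBit (p j) = σ j

/-- A clause as a constraint on the `d` blocks that represent the variables of its literals. The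
Boolean variable `x` is the binary digit `x % b` of block `x / b`; a block that represents several
literals is repeated in the scope. -/
def clauseConstraint (q a b : ℕ) {n : ℕ} (h : d * a ≤ r) (cl : Fin d → Fin n × Bool) :
    Constraint q r ((n / b + 1) * a) where
  arity := d * a
  arity_le := h
  scope k := finProdFinEquiv
    (⟨(cl k.divNat).1 / b, Nat.lt_succ_of_le (Nat.div_le_div_right (cl k.divNat).1.2.le)⟩, k.modNat)
  rel := clauseRel q a (fun j => (cl j).1 % b) fun j => (cl j).2

/-- The constraint that block `B` is a number below `2 ^ b`, and that its binary digits beyond the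
last Boolean variable vanish. -/
def blockConstraint (q a b : ℕ) (n : ℕ) (h : a ≤ r) (B : Fin (n / b + 1)) :
    Constraint q r ((n / b + 1) * a) where
  arity := a
  arity_le := h
  scope i := finProdFinEquiv (B, i)
  rel := Finset.univ.filter fun f => (finFunctionFinEquiv f : ℕ) < 2 ^ min b (n - b * B)

/-- The instance of `#CSP` with as many solutions as the formula: the Boolean variables are cut
into blocks of `b`, and each block is represented by `a` variables over `Fin q`. -/
def CNF.toCSP (q a b : ℕ) (ha : a ≤ r) (hd : d * a ≤ r) (φ : CNF d) : CSP q r where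
  n := (φ.n / b + 1) * a
  constraints := φ.clauses.map (clauseConstraint q a b hd) ++
    (List.finRange (φ.n / b + 1)).map (blockConstraint q a b φ.n ha)

/-- The valuations of `N` blocks of `a` variables, as sequences of `N` numbers below `q ^ a`. -/
def blockEquiv (N a q : ℕ) : (Fin (N * a) → Fin q) ≃ (Fin N → Fin (q ^ a)) :=
  (finProdFinEquiv.symm.arrowCongr (Equiv.refl _)).trans
    ((Equiv.curry (Fin N) (Fin a) (Fin q)).trans
      ((Equiv.refl _).arrowCongr finFunctionFinEquiv))

theorem blockEquiv_apply (N a q : ℕ) (v : Fin (N * a) → Fin q) (B : Fin N) :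
    blockEquiv N a q v B = finFunctionFinEquiv fun i => v (finProdFinEquiv (B, i)) := rfl

theorem CNF.satisfies_toCSP_iff (ha : a ≤ r) (hd : d * a ≤ r) (φ : CNF d)
    (v : Fin ((φ.n / b + 1) * a) → Fin q) :
    (φ.toCSP q a b ha hd).Satisfies v ↔
      (∀ c ∈ φ.clauses, ∃ j, (blockEquiv _ a q v ⟨(c j).1 / b,
        Nat.lt_succ_of_le (Nat.div_le_div_right (c j).1.2.le)⟩ : ℕ).testBit ((c j).1 % b) =
          (c j).2) ∧
      ∀ B, (blockEquiv _ a q v B : ℕ) < 2 ^ min b (φ.n - b * B) := by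
  refine List.forall_mem_append.trans (and_congr (List.forall_mem_map.trans
    (forall₂_congr fun c _ => ?_)) (List.forall_mem_map.trans (forall_congr' fun B => ?_)))
  · refine (Finset.mem_filter_univ _).trans (exists_congr fun j => ?_)
    have (i : Fin a) : (finProdFinEquiv (j, i)).divNat = j ∧ (finProdFinEquiv (j, i)).modNat = i :=
      Prod.ext_iff.1 (finProdFinEquiv.symm_apply_apply (j, i))
    simp only [clauseConstraint, this, blockEquiv_apply]
  · simp only [List.mem_finRange, true_imp_iff]
    exact Finset.mem_filter_univ _

theorem CNF.count_toCSP (hb : 0 < b) (hab : 2 ^ b ≤ q ^ a) (ha : a ≤ r) (hd : d * a ≤ r)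
    (φ : CNF d) : (φ.toCSP q a b ha hd).count = φ.count := by
  have hlt (x : Fin φ.n) : (x : ℕ) / b < φ.n / b + 1 :=
    Nat.lt_succ_of_le (Nat.div_le_div_right x.2.le)
  let bits (v : Fin ((φ.n / b + 1) * a) → Fin q) (x : Fin φ.n) : Bool :=
    (blockEquiv _ a q v ⟨x / b, hlt x⟩ : ℕ).testBit (x % b)
  have hsat (v) : (φ.toCSP q a b ha hd).Satisfies v ↔
      φ.Satisfies (bits v) ∧ ∀ B, (blockEquiv _ a q v B : ℕ) < 2 ^ min b (φ.n - b * B) :=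
    φ.satisfies_toCSP_iff ha hd v
  refine Nat.card_eq_of_bijective
    (fun v : {v // (φ.toCSP q a b ha hd).Satisfies v} =>
      (⟨bits v.1, ((hsat v.1).1 v.2).1⟩ : {α // φ.Satisfies α})) ⟨?_, ?_⟩
  · rintro ⟨v, hv⟩ ⟨w, hw⟩ h
    replace h : bits v = bits w := congrArg Subtype.val h
    replace hv := ((hsat v).1 hv).2
    replace hw := ((hsat w).1 hw).2
    refine Subtype.ext ((blockEquiv _ a q).injective (funext fun B => Fin.ext ?_))
    refine Nat.eq_of_testBit_eq fun p => ?_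
    by_cases hp : p < min b (φ.n - b * B)
    · have hx : b * B + p < φ.n := by omega
      have hpb : p < b := by omega
      have := congrFun h ⟨b * B + p, hx⟩
      have h₁ : (b * B + p) / b = B := by
        rw [Nat.mul_add_div hb, Nat.div_eq_of_lt hpb, add_zero]
      have h₂ : (b * B + p) % b = p := by
        rw [Nat.mul_add_mod, Nat.mod_eq_of_lt hpb]
      simpa only [bits, h₁, h₂] using this
    · have hle : 2 ^ min b (φ.n - b * B) ≤ 2 ^ p := Nat.pow_le_pow_right two_pos (not_lt.1 hp)
      rw [Nat.testBit_lt_two_pow ((hv B).trans_le hle),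
        Nat.testBit_lt_two_pow ((hw B).trans_le hle)]
  · rintro ⟨α, hα⟩
    let w (B : Fin (φ.n / b + 1)) : ℕ :=
      Nat.ofBits fun p : Fin (min b (φ.n - b * B)) => α ⟨b * B + p, by omega⟩
    have hw (B) : w B < 2 ^ min b (φ.n - b * B) := Nat.ofBits_lt_two_pow _
    have hwq (B) : w B < q ^ a :=
      (hw B).trans_le ((Nat.pow_le_pow_right two_pos (min_le_left _ _)).trans hab)
    obtain ⟨v, hv⟩ := (blockEquiv (φ.n / b + 1) a q).surjective fun B => ⟨w B, hwq B⟩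
    have hbits : bits v = α := by
      funext x
      have h₁ := Nat.div_add_mod x b
      have h₂ := Nat.mod_lt x hb
      have h₃ := x.2
      simp only [bits, hv, w]
      rw [Nat.testBit_ofBits_lt _ _ (by omega)]
      congr 1
      exact Fin.ext h₁
    refine ⟨⟨v, (hsat v).2 ⟨hbits ▸ hα, fun B => ?_⟩⟩, Subtype.ext hbits⟩
    rw [hv]
    exact hw B

end Reduction

/-! ### The cells of the encodings -/

theorem List.length_flatMap_of_length_eq {α : Type*} {l : List α} {f : α → List ℕ} {L : ℕ}
    (h : ∀ x ∈ l, (f x).length = L) : (l.flatMap f).length = L * l.length := by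
  induction l with
  | nil => simp
  | cons x l ih =>
    simp only [List.mem_cons, forall_eq_or_imp] at h
    rw [List.flatMap_cons, List.length_append, h.1, ih h.2, List.length_cons]
    ring

theorem List.getD_flatMap_of_length_eq {α : Type*} {l : List α} {f : α → List ℕ} {L : ℕ}
    (h : ∀ x ∈ l, (f x).length = L) {c i : ℕ} (hc : c < l.length) (hi : i < L) :
    (l.flatMap f).getD (L * c + i) 0 = (f l[c]).getD i 0 := by
  induction l generalizing c with
  | nil => simp at hc
  | cons x l ih =>
    simp only [List.mem_cons, forall_eq_or_imp] at h
    rw [List.flatMap_cons]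
    cases c with
    | zero => rw [mul_zero, zero_add, List.getD_append _ _ _ _ (by omega), List.getElem_cons_zero]
    | succ c =>
      rw [List.getD_append_right _ _ _ _ (by rw [h.1]; nlinarith), h.1,
        show L * (c + 1) + i - L = L * c + i by rw [mul_add_one]; omega,
        ih h.2 (by simpa using hc), List.getElem_cons_succ]

theorem List.getD_le_of_forall_mem {l : List ℕ} {W : ℕ} (h : ∀ x ∈ l, x ≤ W) (y : ℕ) :
    l.getD y 0 ≤ W := by
  rcases lt_or_ge y l.length with hy | hy
  · rw [List.getD_eq_getElem _ _ hy]
    exact h _ (List.getElem_mem hy)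
  · rw [List.getD_eq_default _ _ hy]
    exact W.zero_le

namespace CNF

variable {d : ℕ} (φ : CNF d)

theorem length_clause_encode {n : ℕ} (cl : Fin d → Fin n × Bool) :
    ((List.ofFn cl).flatMap fun l => [(l.1 : ℕ), if l.2 then 1 else 0]).length = 2 * d := by
  rw [List.length_flatMap_of_length_eq (L := 2) (by simp), List.length_ofFn]

theorem length_encode : φ.encode.length = 2 + 2 * d * φ.clauses.length := by
  simp only [encode, List.length_cons]
  rw [List.length_flatMap_of_length_eq fun c _ => length_clause_encode c]
  ring

theorem getD_encode {c : ℕ} (hc : c < φ.clauses.length) (j : Fin d) {e : ℕ} (he : e < 2) :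
    φ.encode.getD (2 + (2 * d * c + (2 * j + e))) 0 =
      [((φ.clauses[c] j).1 : ℕ), if (φ.clauses[c] j).2 then 1 else 0].getD e 0 := by
  have hj := j.2
  simp only [encode, add_comm 2, List.getD_cons_succ]
  rw [List.getD_flatMap_of_length_eq (fun c _ => length_clause_encode c) hc (by omega),
    List.getD_flatMap_of_length_eq (L := 2) (by simp) (by simp) he, List.getElem_ofFn]

theorem getD_encode_var {c : ℕ} (hc : c < φ.clauses.length) (j : Fin d) :
    φ.encode.getD (2 + (2 * d * c + (2 * j + 0))) 0 = (φ.clauses[c] j).1 :=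
  φ.getD_encode hc j two_pos

theorem getD_encode_sign {c : ℕ} (hc : c < φ.clauses.length) (j : Fin d) :
    φ.encode.getD (2 + (2 * d * c + (2 * j + 1))) 0 = if (φ.clauses[c] j).2 then 1 else 0 :=
  φ.getD_encode hc j one_lt_two

theorem getD_encode_le (y : ℕ) : φ.encode.getD y 0 ≤ φ.n + φ.clauses.length + 1 := by
  refine List.getD_le_of_forall_mem (fun x hx => ?_) y
  simp only [encode, List.mem_cons, List.mem_flatMap, List.not_mem_nil, or_false] at hx
  rcases hx with rfl | rfl | ⟨c, -, l, -, rfl | rfl⟩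
  · omega
  · omega
  · have := l.1.2
    omega
  · split_ifs <;> omega

end CNF

theorem Constraint.length_encode {q r n : ℕ} (c : Constraint q r n) :
    c.encode.length = 1 + c.arity + q ^ c.arity := by
  simp [encode]
  ring

theorem Constraint.getD_encode {q r n : ℕ} (c : Constraint q r n) (i : ℕ) :
    c.encode.getD i 0 =
      if i = 0 then c.arity
      else if h : i - 1 < c.arity then (c.scope ⟨i - 1, h⟩ : ℕ)
      else if h : i - 1 - c.arity < q ^ c.arity then
        if finFunctionFinEquiv.symm ⟨i - 1 - c.arity, h⟩ ∈ c.rel then 1 else 0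
      else 0 := by
  cases i with
  | zero => rfl
  | succ i =>
    simp only [encode, List.cons_append, List.getD_cons_succ, Nat.add_sub_cancel,
      Nat.succ_ne_zero, if_false]
    split_ifs with h₁ h₂ h₃
    · rw [List.getD_append _ _ _ _ (by simpa using h₁), List.getD_eq_getElem _ _ (by simpa using h₁),
        List.getElem_ofFn]
    · rw [List.getD_append_right _ _ _ _ (by simpa using h₁),
        List.getD_eq_getElem _ _ (by simpa using h₂), List.getElem_ofFn]
      simp only [List.length_ofFn]
      rw [if_pos h₃]
    · rw [List.getD_append_right _ _ _ _ (by simpa using h₁),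
        List.getD_eq_getElem _ _ (by simpa using h₂), List.getElem_ofFn]
      simp only [List.length_ofFn]
      rw [if_neg h₃]
    · rw [List.getD_append_right _ _ _ _ (by simpa using h₁),
        List.getD_eq_default _ _ (by simpa using h₂)]

theorem CSP.getD_encode_le {q r : ℕ} (Ψ : CSP q r) (y : ℕ) :
    Ψ.encode.getD y 0 ≤ Ψ.n + Ψ.m + r + 1 := by
  refine List.getD_le_of_forall_mem (fun x hx => ?_) y
  simp only [encode, Constraint.encode, List.mem_cons, List.mem_flatMap, List.cons_append,
    List.mem_append, List.mem_ofFn] at hx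
  rcases hx with rfl | rfl | ⟨c, -, rfl | ⟨i, rfl⟩ | ⟨j, rfl⟩⟩
  · omega
  · omega
  · have := c.arity_le
    omega
  · have := (c.scope i).2
    omega
  · split_ifs <;> omega

section Reduction

variable {q a b d r : ℕ} (ha : a ≤ r) (hd : d * a ≤ r) (φ : CNF d)

theorem CNF.m_toCSP : (φ.toCSP q a b ha hd).m = φ.clauses.length + (φ.n / b + 1) := by
  simp [CSP.m, toCSP]

theorem CNF.encode_toCSP : (φ.toCSP q a b ha hd).encode =
    (φ.n / b + 1) * a :: (φ.clauses.length + (φ.n / b + 1)) ::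
      (φ.clauses.flatMap (fun c => (clauseConstraint q a b hd c).encode) ++
        (List.finRange (φ.n / b + 1)).flatMap fun B => (blockConstraint q a b φ.n ha B).encode) := by
  rw [CSP.encode, m_toCSP]
  simp only [toCSP, List.flatMap_append, List.flatMap_map]

theorem CNF.length_clauses_flatMap :
    (φ.clauses.flatMap fun c => (clauseConstraint q a b hd c).encode).length =
      (1 + d * a + q ^ (d * a)) * φ.clauses.length :=
  List.length_flatMap_of_length_eq fun _ _ => Constraint.length_encode _

theorem CNF.length_encode_toCSP : (φ.toCSP q a b ha hd).encode.length =
    2 + (1 + d * a + q ^ (d * a)) * φ.clauses.length + (1 + a + q ^ a) * (φ.n / b + 1) := by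
  rw [encode_toCSP]
  simp only [List.length_cons, List.length_append]
  rw [length_clauses_flatMap, List.length_flatMap_of_length_eq (L := 1 + a + q ^ a)
    fun _ _ => Constraint.length_encode _, List.length_finRange]
  ring

theorem CNF.getD_encode_toCSP_clause {c i : ℕ} (hc : c < φ.clauses.length)
    (hi : i < 1 + d * a + q ^ (d * a)) :
    (φ.toCSP q a b ha hd).encode.getD (2 + (1 + d * a + q ^ (d * a)) * c + i) 0 =
      (clauseConstraint q a b hd φ.clauses[c]).encode.getD i 0 := by
  rw [encode_toCSP, add_assoc, add_comm 2]
  simp only [List.getD_cons_succ]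
  rw [List.getD_append, List.getD_flatMap_of_length_eq (L := 1 + d * a + q ^ (d * a))
    (fun _ _ => Constraint.length_encode _) hc hi]
  rw [length_clauses_flatMap]
  nlinarith

theorem CNF.getD_encode_toCSP_block (B : Fin (φ.n / b + 1)) {i : ℕ} (hi : i < 1 + a + q ^ a) :
    (φ.toCSP q a b ha hd).encode.getD
      (2 + (1 + d * a + q ^ (d * a)) * φ.clauses.length + (1 + a + q ^ a) * B + i) 0 =
        (blockConstraint q a b φ.n ha B).encode.getD i 0 := by
  rw [encode_toCSP, add_assoc, add_assoc, add_comm 2]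
  simp only [List.getD_cons_succ]
  rw [List.getD_append_right, length_clauses_flatMap, Nat.add_sub_cancel_left,
    List.getD_flatMap_of_length_eq (L := 1 + a + q ^ a) (fun _ _ => Constraint.length_encode _)
      (by simpa using B.is_le) hi]
  · simp
  · rw [length_clauses_flatMap]
    omega

/-- The truth table entry at `k` of `clauseRel`, when a literal with the position `p` in its block
and the sign `σ` is given as the number `2 * p + σ`. -/
def clauseBit (q a k : ℕ) (g : Fin d → ℕ) : ℕ :=
  if h : k < q ^ (d * a) then
    if finFunctionFinEquiv.symm ⟨k, h⟩ ∈ clauseRel q a (fun j => g j / 2) fun j => g j % 2 = 1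
    then 1 else 0
  else 0

/-- The number in position `i` of the constraint of clause `c`, computed from the encoding of the
formula in `M`. -/
def clauseCell (q a b d i c : ℕ) (M : ℕ → ℕ) : ℕ :=
  if i = 0 then d * a
  else if i - 1 < d * a then
    (i - 1) % a + a * (M (2 + (2 * d * c + (2 * ((i - 1) / a) + 0))) / b)
  else if ∀ j : Fin d, 2 * (M (2 + (2 * d * c + (2 * j + 0))) % b) +
      M (2 + (2 * d * c + (2 * j + 1))) < 2 * b then
    clauseBit q a (i - 1 - d * a) fun j : Fin d =>
      2 * (M (2 + (2 * d * c + (2 * j + 0))) % b) + M (2 + (2 * d * c + (2 * j + 1)))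
  else 0

/-- The number in position `i` of the constraint of block `B`, computed from the number of Boolean
variables in `M 0`. The length `min b (n - b * B)` of the block is written as
`b - (b - (n - b * B))`, since the machine has only the truncated subtraction. -/
def blockCell (q a b i B : ℕ) (M : ℕ → ℕ) : ℕ :=
  if i = 0 then a
  else if i - 1 < a then i - 1 + a * B
  else if ∀ _ : Unit, b - (b - (M 0 - b * B)) < b + 1 then
    (if i - 1 - a < q ^ a ∧ i - 1 - a < 2 ^ (b - (b - (M 0 - b * B))) then 1 else 0)
  else 0

theorem evaluable_clauseCell (q a b d i : ℕ) : RAM.Evaluable (clauseCell q a b d i) := by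
  have hM (j e : ℕ) : RAM.Evaluable fun c M => M (2 + (2 * d * c + (2 * j + e))) :=
    (RAM.Evaluable.const 2 |>.add ((RAM.Evaluable.const (2 * d) |>.mul .counter).add
      (.const (2 * j + e)))).load
  unfold clauseCell
  by_cases h₀ : i = 0
  · simpa only [if_pos h₀] using RAM.Evaluable.const _
  by_cases h₁ : i - 1 < d * a
  · simpa only [if_neg h₀, if_pos h₁] using
      (RAM.Evaluable.const _).add ((RAM.Evaluable.const a).mul ((hM _ _).div (.const b)))
  · simp only [if_neg h₀, if_neg h₁]
    convert RAM.Evaluable.table (fun j : Fin d => 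
      ((RAM.Evaluable.const 2).mul ((hM j 0).mod (.const b))).add (hM j 1)) (2 * b)
         (clauseBit q a (i - 1 - d * a))

theorem evaluable_blockCell (q a b i : ℕ) : RAM.Evaluable (blockCell q a b i) := by
  unfold blockCell
  by_cases h₀ : i = 0
  · simpa only [if_pos h₀] using RAM.Evaluable.const _
  by_cases h₁ : i - 1 < a
  · simpa only [if_neg h₀, if_pos h₁] using
      (RAM.Evaluable.const _).add ((RAM.Evaluable.const a).mul .counter)
  · have h : RAM.Evaluable fun B M => b - (b - (M 0 - b * B)) :=
      (RAM.Evaluable.const b).sub ((RAM.Evaluable.const b).sub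
        ((RAM.Evaluable.const 0).load.sub ((RAM.Evaluable.const b).mul .counter)))
    simpa only [if_neg h₀, if_neg h₁] using RAM.Evaluable.table (fun _ : Unit => h) (b + 1)
      fun t => if i - 1 - a < q ^ a ∧ i - 1 - a < 2 ^ t () then 1 else 0

theorem clauseCell_eq (hb : 0 < b) {c : ℕ} (hc : c < φ.clauses.length) {M : ℕ → ℕ}
    (hM : ∀ y < 2 + 2 * d * (c + 1), M y = φ.encode.getD y 0) (i : ℕ) :
    clauseCell q a b d i c M = (clauseConstraint q a b hd φ.clauses[c]).encode.getD i 0 := by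
  have hvar (j : Fin d) : M (2 + (2 * d * c + (2 * j + 0))) = (φ.clauses[c] j).1 := by
    rw [hM _ (by have := j.2; rw [mul_add_one]; omega), φ.getD_encode_var hc]
  have hsign (j : Fin d) : M (2 + (2 * d * c + (2 * j + 1))) =
      if (φ.clauses[c] j).2 then 1 else 0 := by
    rw [hM _ (by have := j.2; rw [mul_add_one]; omega), φ.getD_encode_sign hc]
  rw [Constraint.getD_encode, clauseCell]
  refine if_congr Iff.rfl rfl ?_
  by_cases h₁ : i - 1 < d * a
  · rw [if_pos h₁, dif_pos (show i - 1 < (clauseConstraint q a b hd φ.clauses[c]).arity from h₁)]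
    have hj : (i - 1) / a < d := Nat.div_lt_of_lt_mul (by rwa [mul_comm])
    rw [hvar ⟨(i - 1) / a, hj⟩]
    rfl
  · rw [if_neg h₁, dif_neg (show ¬ i - 1 < (clauseConstraint q a b hd φ.clauses[c]).arity from h₁)]
    simp only [hvar, hsign]
    rw [if_pos fun j => by
      have := Nat.mod_lt (φ.clauses[c] j).1 hb
      split_ifs <;> omega]
    have hp (j : Fin d) : (2 * ((φ.clauses[c] j).1 % b : ℕ) +
        if (φ.clauses[c] j).2 then 1 else 0) / 2 = (φ.clauses[c] j).1 % b := by
      split_ifs <;> omega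
    have hσ (j : Fin d) : decide ((2 * ((φ.clauses[c] j).1 % b : ℕ) +
        if (φ.clauses[c] j).2 then 1 else 0) % 2 = 1) = (φ.clauses[c] j).2 := by
      cases (φ.clauses[c] j).2 <;> simp
    simp only [clauseBit, hp, hσ]
    rfl

theorem blockCell_eq {n : ℕ} (B : Fin (n / b + 1)) {M : ℕ → ℕ} (hM : M 0 = n) (i : ℕ) :
    blockCell q a b i B M = (blockConstraint q a b n ha B).encode.getD i 0 := by
  have hmin : b - (b - (n - b * B)) = min b (n - b * B) := by omega
  rw [Constraint.getD_encode, blockCell]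
  refine if_congr Iff.rfl rfl ?_
  by_cases h₁ : i - 1 < a
  · rw [if_pos h₁, dif_pos (show i - 1 < (blockConstraint q a b n ha B).arity from h₁)]
    rfl
  · rw [if_neg h₁, dif_neg (show ¬ i - 1 < (blockConstraint q a b n ha B).arity from h₁),
      if_pos fun _ => by omega, hM, hmin]
    by_cases h₂ : i - 1 - a < q ^ a
    · have h₂' : i - 1 - (blockConstraint q a b n ha B).arity <
          q ^ (blockConstraint q a b n ha B).arity := h₂
      rw [dif_pos h₂']
      refine if_congr ?_ rfl rfl
      refine Iff.trans ?_ (Finset.mem_filter_univ _).symm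
      change _ ↔ (finFunctionFinEquiv (finFunctionFinEquiv.symm
        (⟨i - 1 - a, h₂⟩ : Fin (q ^ a))) : ℕ) < _
      rw [Equiv.apply_symm_apply]
      exact and_iff_right h₂
    · have h₂' : ¬ i - 1 - (blockConstraint q a b n ha B).arity <
          q ^ (blockConstraint q a b n ha B).arity := h₂
      rw [dif_neg h₂',
        if_neg fun H => h₂ H.1]

end Reduction

/-! ### The reduction as a program -/

section Reduction

open RAM

variable {q a b d r : ℕ}

/-- The memory of the machine during the reduction always consists of output `o` on a set `S` of
cells and input `I` elsewhere; writing a block of correct values enlarges the set. -/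
theorem RAM.writeBlock_eq_ite {M o : ℕ → ℕ} {base L : ℕ} {v : ℕ → ℕ} {S S' : ℕ → Prop}
    [DecidablePred S] [DecidablePred S'] {I : ℕ → ℕ} (hM : M = fun y => if S y then o y else I y)
    (hv : ∀ i < L, v i = o (base + i)) (hS : ∀ y, S' y ↔ (base ≤ y ∧ y < base + L) ∨ S y) :
    writeBlock M base L v = fun y => if S' y then o y else I y := by
  funext y
  simp only [writeBlock, hS, hM]
  by_cases h : base ≤ y ∧ y < base + L
  · rw [if_pos h, if_pos (Or.inl h), hv _ (by omega), Nat.add_sub_cancel' h.1]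
  · rw [if_neg h]
    exact if_congr (by simp [h]) rfl rfl

theorem reduction_time_le {m N Z A K₁ K₂ K₃ K₄ K₅ : ℕ} (hm : m + 1 ≤ Z) (hN : N ≤ Z) :
    K₁ * (A * Z) + ((m + 1) * (K₂ * (A * Z) + 2 * m + 5) + (K₃ * (A * Z) +
      ((N + 1) * (K₄ * (A * Z) + 2 * N + 5) + K₅ * (A * Z)))) ≤
    (K₁ * A + (K₂ * A + 7) + K₃ * A + 2 * (K₄ * A + 7) + K₅ * A) * Z ^ 2 := by
  have hZ : Z ≤ Z ^ 2 := Nat.le_self_pow two_ne_zero Z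
  calc _ ≤ K₁ * (A * Z ^ 2) + (Z * (K₂ * (A * Z) + 2 * Z + 5 * Z) + (K₃ * (A * Z ^ 2) +
        ((2 * Z) * (K₄ * (A * Z) + 2 * Z + 5 * Z) + K₅ * (A * Z ^ 2)))) := by
        gcongr <;> omega
    _ = _ := by ring

theorem CNF.exists_prog_toCSP (hq : 1 < q) (ha₀ : 0 < a) (hb : 0 < b) (ha : a ≤ r)
    (hd : d * a ≤ r) : ∃ p K, ∀ φ : CNF d, ∃ s t, Exec p (State.init φ.encode) s t ∧
      s.mem = (State.init (φ.toCSP q a b ha hd).encode).mem ∧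
      t ≤ K * (φ.n + φ.clauses.length + 1) ^ 2 := by
  set L := 1 + d * a + q ^ (d * a) with hL
  set L' := 1 + a + q ^ a with hL'
  have hdL : 2 * d ≤ L := by
    have h₁ : d * a < q ^ (d * a) := Nat.lt_pow_self hq
    have h₂ : d ≤ d * a := Nat.le_mul_of_pos_right d ha₀
    omega
  obtain ⟨p₁, K₁, hp₁⟩ := exists_takes_setCounter (Evaluable.const 1).load
  obtain ⟨p₂, K₂, hp₂⟩ := exists_takes_writeBlock
    ((Evaluable.const 2).add ((Evaluable.const L).mul .counter)) (evaluable_clauseCell q a b d) L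
  have hN : Evaluable fun _ M => M 0 / b + 1 :=
    ((Evaluable.const 0).load.div (.const b)).add (.const 1)
  obtain ⟨p₃, K₃, hp₃⟩ := exists_takes_setCounter hN
  obtain ⟨p₄, K₄, hp₄⟩ := exists_takes_writeBlock
    (((Evaluable.const 2).add ((Evaluable.const L).mul (Evaluable.const 1).load)).add
      ((Evaluable.const L').mul .counter)) (evaluable_blockCell q a b) L'
  obtain ⟨p₅, K₅, hp₅⟩ := exists_takes_writeBlock (.const 0)
    (v := fun i c M => if i = 0 then (M 0 / b + 1) * a else M 1 + (M 0 / b + 1)) (fun i => by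
      by_cases hi : i = 0
      · simpa only [if_pos hi] using hN.mul (.const a)
      · simpa only [if_neg hi] using (Evaluable.const 1).load.add hN) 2
  -- With `Z = n + m + 1`, every number in the counter and in the memory is below `A * Z`.
  set A := a + r + 4 with hA
  refine ⟨.seq p₁ (.seq (countdown p₂) (.seq p₃ (.seq (countdown p₄) p₅))),
    K₁ * A + (K₂ * A + 7) + K₃ * A + 2 * (K₄ * A + 7) + K₅ * A, fun φ => ?_⟩
  set n := φ.n with hn
  set m := φ.clauses.length with hm
  set N := n / b + 1 with hNdef
  have hNn : N ≤ n + 1 := Nat.succ_le_succ (Nat.div_le_self n b)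
  set I : ℕ → ℕ := fun y => φ.encode.getD y 0 with hI
  set O : ℕ → ℕ := fun y => (φ.toCSP q a b ha hd).encode.getD y 0 with hO
  have hI₀ : I 0 = n := rfl
  have hI₁ : I 1 = m := rfl
  have hO₀ : O 0 = N * a := by simp only [hO, encode_toCSP]; rfl
  have hO₁ : O 1 = m + N := by simp only [hO, encode_toCSP]; rfl
  set Z := n + m + 1 with hZ
  set W := A * Z - 1 with hW
  have hAZ : A * Z = W + 1 := by
    have : 0 < A * Z := by positivity
    omega
  have hWle : n * a + a + n + m + r + 3 ≤ W := by
    have h₁ : A * Z = a * n + a * m + a + (r * n + r * m + r) + 4 * (n + m + 1) := by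
      rw [hA, hZ]; ring
    have h₂ : n * a = a * n := mul_comm _ _
    omega
  have hNa : N * a ≤ n * a + a := by nlinarith
  have hIW (y) : I y ≤ W := (φ.getD_encode_le y).trans (by omega)
  have hOW (y) : O y ≤ W := by
    refine ((φ.toCSP q a b ha hd).getD_encode_le y).trans ?_
    rw [m_toCSP]
    change N * a + (m + N) + r + 1 ≤ W
    omega
  have hsize {u : ℕ} (hu : u ≤ W) : u.size ≤ W :=
    Nat.size_le.2 (Nat.lt_two_pow_self.trans_le (Nat.pow_le_pow_right two_pos hu))
  have hbd {c : ℕ} {S : ℕ → Prop} [DecidablePred S] (hc : c ≤ W) :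
      Bounded W c fun y => if S y then O y else I y := by
    refine ⟨hsize hc, fun y => ?_⟩
    dsimp only
    split_ifs
    exacts [hsize (hOW y), hsize (hIW y)]
  have hI₂ {y : ℕ} (hy : 2 + 2 * d * m ≤ y) : I y = 0 :=
    List.getD_eq_default _ _ (by rw [φ.length_encode]; exact hy)
  have hO₂ {y : ℕ} (hy : 2 + L * m + L' * N ≤ y) : O y = 0 :=
    List.getD_eq_default _ _ (by rw [φ.length_encode_toCSP]; exact hy)
  -- The clauses are replaced by their constraints in place, from the last to the first. As a
  -- constraint is longer than a clause, the clauses still to be read are not overwritten.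
  let M₁ (c : ℕ) : ℕ → ℕ := fun y => if 2 + L * c ≤ y ∧ y < 2 + L * m then O y else I y
  have loop₁ : Takes (countdown p₂) m (M₁ m) 0 (M₁ 0) ((m + 1) * (K₂ * (W + 1) + 2 * m + 5)) := by
    refine takes_countdown fun c hc => ?_
    have hbd' : Bounded W c (M₁ (c + 1)) := hbd (by omega)
    have hcm : L * (c + 1) ≤ L * m := Nat.mul_le_mul_left L hc
    have hLc : L * (c + 1) = L * c + L := mul_add_one L c
    convert hp₂ W c _ hbd' using 1
    refine (writeBlock_eq_ite rfl (fun i hi => ?_) fun y => by omega).symm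
    rw [clauseCell_eq hd φ hb hc (fun y hy => ?_)]
    · exact (φ.getD_encode_toCSP_clause ha hd hc hi).symm
    · refine if_neg fun h => ?_
      have := Nat.mul_le_mul_right (c + 1) hdL
      omega
  -- The constraints of the blocks fill the cells behind them, again from the last to the first.
  -- The cells behind the output count as written, since they hold `0` in both encodings.
  let M₂ (B : ℕ) : ℕ → ℕ := fun y =>
    if (2 ≤ y ∧ y < 2 + L * m) ∨ 2 + L * m + L' * B ≤ y then O y else I y
  have hM₂ : M₁ 0 = M₂ N := by
    funext y
    simp only [M₁, M₂, mul_zero, add_zero]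
    by_cases hy : 2 + L * m + L' * N ≤ y
    · have := Nat.mul_le_mul_right m hdL
      rw [if_neg (by omega), if_pos (Or.inr hy), hO₂ hy, hI₂ (by omega)]
    · simp only [hy, or_false]
  have loop₂ : Takes (countdown p₄) N (M₂ N) 0 (M₂ 0)
      ((N + 1) * (K₄ * (W + 1) + 2 * N + 5)) := by
    refine takes_countdown fun B hB => ?_
    have hbd' : Bounded W B (M₂ (B + 1)) := hbd (by omega)
    have h₀ : M₂ (B + 1) 0 = n := if_neg (by omega)
    have h₁ : M₂ (B + 1) 1 = m := if_neg (by omega)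
    have hLB : L' * (B + 1) = L' * B + L' := mul_add_one L' B
    convert hp₄ W B _ hbd' using 1
    rw [h₁]
    refine (writeBlock_eq_ite rfl (fun i hi => ?_) fun y => by omega).symm
    rw [blockCell_eq ha ⟨B, hB⟩ h₀]
    exact (φ.getD_encode_toCSP_block ha hd ⟨B, hB⟩ hi).symm
  have step₁ : Takes p₁ 0 I m I (K₁ * (W + 1)) :=
    hp₁ W 0 I ⟨hsize (Nat.zero_le _), fun y => hsize (hIW y)⟩
  have hM₁ : M₁ m = I := by
    funext y
    exact if_neg (by omega)
  have step₃ : Takes p₃ 0 (M₂ N) N (M₂ N) (K₃ * (W + 1)) := by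
    have h₀ : M₂ N 0 = n := if_neg (by omega)
    simpa only [h₀] using hp₃ W 0 (M₂ N) (hbd (Nat.zero_le _))
  have step₅ : Takes p₅ 0 (M₂ 0) 0 O (K₅ * (W + 1)) := by
    have h₀ : M₂ 0 0 = n := if_neg (by omega)
    have h₁ : M₂ 0 1 = m := if_neg (by omega)
    convert hp₅ W 0 (M₂ 0) (hbd (Nat.zero_le _)) using 1
    rw [h₀, h₁]
    have : O = fun y => if True then O y else I y := by simp
    rw [this]
    refine (writeBlock_eq_ite (base := 0) rfl (fun i hi => ?_) fun y => ?_).symm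
    swap
    · rw [mul_zero, true_iff]
      omega
    interval_cases i
    · exact hO₀.symm
    · exact hO₁.symm
  rw [hM₁] at loop₁
  rw [hM₂] at loop₁
  obtain ⟨s, t, hs, -, hmem, ht⟩ :=
    step₁.seq (loop₁.seq (step₃.seq (loop₂.seq step₅))) (State.init φ.encode) rfl rfl
  refine ⟨s, t, hs, hmem, ht.trans ?_⟩
  rw [← hAZ]
  exact reduction_time_le (by omega) (by omega)

end Reduction

/-! ### Running times -/

open Filter Topology in
/-- A polynomial factor is absorbed by an increase of the base. -/
theorem exists_pow_mul_pow_le (e : ℕ) {γ γ' : ℝ} (hγ : 0 < γ) (hγ' : γ < γ') :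
    ∃ C : ℝ, 0 ≤ C ∧ ∀ n : ℕ, ((n : ℝ) + 1) ^ e * γ ^ n ≤ C * γ' ^ n := by
  have hpos : 0 < γ' := hγ.trans hγ'
  have hρ : 0 < γ / γ' := by positivity
  have ht := tendsto_pow_const_mul_const_pow_of_abs_lt_one e
    (r := γ / γ') (by rw [abs_of_pos hρ, div_lt_one hpos]; exact hγ')
  obtain ⟨B, hB⟩ := ht.bddAbove_range
  have hB' (n : ℕ) : (n : ℝ) ^ e * (γ / γ') ^ n ≤ B := hB ⟨n, rfl⟩
  have hB₀ : 0 ≤ B := le_trans (by positivity) (hB' 0)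
  refine ⟨B / (γ / γ'), by positivity, fun n => ?_⟩
  have h := hB' (n + 1)
  rw [pow_succ (γ / γ'), ← mul_assoc, ← le_div_iff₀ hρ, div_pow, mul_div_assoc',
    div_le_iff₀ (by positivity)] at h
  exact_mod_cast h

open Filter Topology in
/-- If `a` variables over a domain of size `q` hold `b` bits, then up to rounding `b = a * log₂ q`;
for large `a` the rounding costs less than what is gained from `β < q`. -/
theorem exists_block_sizes {q : ℕ} (hq : 2 ≤ q) {β : ℝ} (hβ : 1 ≤ β) (hβq : β < q) :
    ∃ a b : ℕ, ∃ γ : ℝ, 0 < a ∧ 0 < b ∧ 2 ^ b ≤ q ^ a ∧ 1 < γ ∧ γ < 2 ∧ β ^ a ≤ γ ^ b := by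
  have hq₀ : (0 : ℝ) < q := by positivity
  obtain ⟨a, ha⟩ := exists_pow_lt_of_lt_one (one_half_pos (α := ℝ)) ((div_lt_one hq₀).2 hβq)
  rw [div_pow, div_lt_iff₀ (by positivity)] at ha
  have hlog : q ^ a < 2 ^ (Nat.log 2 (q ^ a) + 1) := Nat.lt_pow_succ_log_self one_lt_two _
  have hβ₂ : β ^ a < 2 ^ Nat.log 2 (q ^ a) := by
    have : (q : ℝ) ^ a < 2 ^ (Nat.log 2 (q ^ a) + 1) := by exact_mod_cast hlog
    rw [pow_succ] at this
    linarith
  have hβa : 1 ≤ β ^ a := one_le_pow₀ hβ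
  have ha₀ : 0 < a := by
    rcases Nat.eq_zero_or_pos a with rfl | h
    · norm_num at ha
    · exact h
  have hb₀ : 0 < Nat.log 2 (q ^ a) := by
    rcases Nat.eq_zero_or_pos (Nat.log 2 (q ^ a)) with h | h
    · rw [h] at hβ₂
      linarith
    · exact h
  have h₁ : ∀ᶠ x in 𝓝[<] (2 : ℝ), β ^ a < x ^ Nat.log 2 (q ^ a) :=
    (((continuous_pow _).tendsto (2 : ℝ)).eventually (lt_mem_nhds hβ₂)).filter_mono
      nhdsWithin_le_nhds
  have h₂ : ∀ᶠ x in 𝓝[<] (2 : ℝ), 1 < x :=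
    (lt_mem_nhds one_lt_two).filter_mono nhdsWithin_le_nhds
  obtain ⟨γ, ⟨hγ₁, hγ₂⟩, hγ₃⟩ := ((h₁.and h₂).and self_mem_nhdsWithin).exists
  exact ⟨a, _, γ, ha₀, hb₀, Nat.pow_log_le_self 2 (by positivity), hγ₂, hγ₃, hγ₁.le⟩

/-- As the clauses are pairwise different, their number is polynomial in the number of variables. -/
theorem CNF.size_le {d : ℕ} (hd : 1 ≤ d) (φ : CNF d) :
    φ.n + φ.clauses.length + 1 ≤ 2 ^ (d + 1) * (φ.n + 1) ^ (d + 1) := by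
  have hm : φ.clauses.length ≤ (φ.n * 2) ^ d := by
    simpa using φ.nodup.length_le_card
  have h₁ : (φ.n * 2) ^ d ≤ (2 * (φ.n + 1)) ^ d := Nat.pow_le_pow_left (by omega) d
  have h₂ : 2 * (φ.n + 1) ≤ (2 * (φ.n + 1)) ^ d := Nat.le_self_pow (by omega) _
  rw [← mul_pow, pow_succ]
  nlinarith

/-- The machine needs a positive time on the instances without constraints, so the time bound
cannot have a base that is negative or zero. -/
theorem SharpCSPSolvable.base_pos {q r : ℕ} {x : ℝ} (h : SharpCSPSolvable q r x) : 0 < x := by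
  obtain ⟨C, k, P, hP⟩ := h
  obtain ⟨_, t₀, h₀, -, ht₀⟩ := hP ⟨0, []⟩
  obtain ⟨_, t₁, h₁, -, ht₁⟩ := hP ⟨1, []⟩
  have h₀ : (1 : ℝ) ≤ t₀ := by exact_mod_cast h₀.one_le
  have h₁ : (1 : ℝ) ≤ t₁ := by exact_mod_cast h₁.one_le
  simp [CSP.m] at ht₀ ht₁
  by_contra! hx
  have hC : 0 ≤ C * (1 + 1) ^ k := mul_nonneg (by linarith) (by positivity)
  nlinarith

theorem SharpCSPSolvable.mono {q r : ℕ} {x y : ℝ} (h : SharpCSPSolvable q r x) (hxy : x ≤ y) :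
    ∃ (C : ℝ) (k : ℕ), 0 ≤ C ∧ RAM.SolvableInTime (CSP.encode (q := q) (r := r)) CSP.count
      fun Ψ => y ^ Ψ.n * (C * ((Ψ.n : ℝ) + (Ψ.m : ℝ) + 1) ^ k) := by
  have hx := h.base_pos
  obtain ⟨C, k, P, hP⟩ := h
  refine ⟨|C|, k, abs_nonneg C, P, fun Ψ => ?_⟩
  obtain ⟨s, t, hs, hc, ht⟩ := hP Ψ
  refine ⟨s, t, hs, hc, ht.trans ?_⟩
  calc x ^ Ψ.n * (C * ((Ψ.n : ℝ) + (Ψ.m : ℝ) + 1) ^ k)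
      ≤ x ^ Ψ.n * (|C| * ((Ψ.n : ℝ) + (Ψ.m : ℝ) + 1) ^ k) := by
        gcongr
        exact le_abs_self C
    _ ≤ y ^ Ψ.n * (|C| * ((Ψ.n : ℝ) + (Ψ.m : ℝ) + 1) ^ k) := by gcongr

/-- An algorithm for the constraint satisfaction problem is run after the reduction. The reduction
leaves the memory as if the constraint satisfaction problem were the input; it remains to clear the
registers. -/
theorem CNF.solvableInTime_of_toCSP {q a b d r : ℕ} (hq : 1 < q) (ha₀ : 0 < a) (hb : 0 < b)
    (hab : 2 ^ b ≤ q ^ a) (ha : a ≤ r) (hd : d * a ≤ r) {T : CSP q r → ℝ}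
    (h : RAM.SolvableInTime (CSP.encode (q := q) (r := r)) CSP.count T) :
    ∃ K : ℕ, RAM.SolvableInTime (CNF.encode (d := d)) CNF.count fun φ =>
      K * ((φ.n + φ.clauses.length + 1 : ℕ) : ℝ) ^ 2 + T (φ.toCSP q a b ha hd) := by
  obtain ⟨P, hP⟩ := h
  obtain ⟨p, K, hp⟩ := CNF.exists_prog_toCSP (b := b) hq ha₀ hb ha hd
  refine ⟨K + (p.bound + 1), .seq p (.seq (RAM.clear p.bound) P), fun φ => ?_⟩
  obtain ⟨s₁, t₁, hs₁, hm₁, ht₁⟩ := hp φ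
  obtain ⟨s₂, t₂, hs₂, hc₂, ht₂⟩ := hP (φ.toCSP q a b ha hd)
  have hclear := RAM.exec_clear p.bound s₁
  have hinit : (⟨fun x => if x < p.bound then 0 else s₁.reg x, s₁.mem⟩ : RAM.State) =
      .init (φ.toCSP q a b ha hd).encode := by
    rw [hm₁]
    refine congrArg (RAM.State.mk · _) (funext fun x => ?_)
    split_ifs with hx
    · rfl
    · exact hs₁.reg_eq_of_bound_le (not_lt.1 hx)
  rw [hinit] at hclear
  refine ⟨s₂, _, hs₁.seq (hclear.seq hs₂), hc₂.trans (CNF.count_toCSP hb hab ha hd φ), ?_⟩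
  have h₁ : t₁ + (p.bound + 1) ≤
      (K + (p.bound + 1)) * (φ.n + φ.clauses.length + 1) ^ 2 := by
    rw [add_mul]
    exact add_le_add ht₁ (Nat.le_mul_of_pos_right _ (by positivity))
  have h₂ : ((t₁ + (p.bound + 1) : ℕ) : ℝ) ≤
      ((K + (p.bound + 1) : ℕ) : ℝ) * ((φ.n + φ.clauses.length + 1 : ℕ) : ℝ) ^ 2 := by
    exact_mod_cast h₁
  push_cast at h₂ ⊢
  linarith

/-- The clause width enters only through the constant, so that one base `γ'` serves all `d`. -/
theorem CNF.solvableInTime_of_sharpCSPSolvable {q a b d r : ℕ} (hq : 1 < q) (ha₀ : 0 < a)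
    (hb : 0 < b) (hab : 2 ^ b ≤ q ^ a) (ha : a ≤ r) (hd : d * a ≤ r) (hd₁ : 1 ≤ d)
    {x β γ γ' : ℝ} (hxβ : x ≤ β) (hβ : 1 ≤ β) (hγ : 1 < γ) (hβγ : β ^ a ≤ γ ^ b) (hγ' : γ < γ')
    (h : SharpCSPSolvable q r x) :
    ∃ C : ℝ, RAM.SolvableInTime (CNF.encode (d := d)) CNF.count fun φ => C * γ' ^ φ.n := by
  obtain ⟨C, k, hC, h⟩ := h.mono hxβ
  obtain ⟨K, P, hP⟩ := CNF.solvableInTime_of_toCSP hq ha₀ hb hab ha hd h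
  obtain ⟨B, hB, hpoly⟩ := exists_pow_mul_pow_le ((d + 1) * (k + 2)) (one_pos.trans hγ) hγ'
  refine ⟨(K + γ ^ b * C * (a + 2) ^ k) * (2 ^ (d + 1)) ^ (k + 2) * B, P, fun φ => ?_⟩
  obtain ⟨s, t, hs, hc, ht⟩ := hP φ
  refine ⟨s, t, hs, hc, ht.trans ?_⟩
  have hdiv : φ.n / b * b ≤ φ.n := Nat.div_mul_le_self φ.n b
  have hdiv' : φ.n / b ≤ φ.n := Nat.div_le_self φ.n b
  have hpow : β ^ ((φ.n / b + 1) * a) ≤ γ ^ b * γ ^ φ.n := by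
    calc β ^ ((φ.n / b + 1) * a) = (β ^ a) ^ (φ.n / b + 1) := by rw [mul_comm, pow_mul]
      _ ≤ (γ ^ b) ^ (φ.n / b + 1) := by gcongr
      _ = γ ^ (b + φ.n / b * b) := by rw [← pow_mul]; ring_nf
      _ ≤ γ ^ (b + φ.n) := pow_le_pow_right₀ hγ.le (by omega)
      _ = _ := pow_add ..
  set Z : ℝ := ((φ.n + φ.clauses.length + 1 : ℕ) : ℝ) with hZ
  have hZ₁ : 1 ≤ Z := by
    rw [hZ]
    exact_mod_cast Nat.le_add_left 1 _
  have hZle : Z ≤ 2 ^ (d + 1) * ((φ.n : ℝ) + 1) ^ (d + 1) := by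
    rw [hZ]
    exact_mod_cast φ.size_le hd₁
  have hsize : (((φ.toCSP q a b ha hd).n : ℝ) + ((φ.toCSP q a b ha hd).m : ℝ) + 1) ≤
      (a + 2) * Z := by
    have : (φ.n / b + 1) * a + (φ.clauses.length + (φ.n / b + 1)) + 1 ≤
        (a + 2) * (φ.n + φ.clauses.length + 1) := by nlinarith
    rw [m_toCSP, hZ]
    exact_mod_cast this
  have hγn : 1 ≤ γ ^ φ.n := one_le_pow₀ hγ.le
  calc K * Z ^ 2 + β ^ ((φ.n / b + 1) * a) *
        (C * (((φ.toCSP q a b ha hd).n : ℝ) + ((φ.toCSP q a b ha hd).m : ℝ) + 1) ^ k)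
      ≤ K * Z ^ 2 + γ ^ b * γ ^ φ.n * (C * ((a + 2) * Z) ^ k) := by gcongr
    _ ≤ K * (Z ^ (k + 2) * γ ^ φ.n) + γ ^ b * γ ^ φ.n * (C * ((a + 2) ^ k * Z ^ (k + 2))) := by
        rw [mul_pow]
        gcongr ?_ * ?_ + _ * (_ * (_ * ?_))
        · calc Z ^ 2 ≤ Z ^ (k + 2) := pow_le_pow_right₀ hZ₁ (by omega)
            _ ≤ _ := le_mul_of_one_le_right (by positivity) hγn
        · exact pow_le_pow_right₀ hZ₁ (by omega)
    _ = (K + γ ^ b * C * (a + 2) ^ k) * (Z ^ (k + 2) * γ ^ φ.n) := by ring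
    _ ≤ (K + γ ^ b * C * (a + 2) ^ k) *
        ((2 ^ (d + 1) * ((φ.n : ℝ) + 1) ^ (d + 1)) ^ (k + 2) * γ ^ φ.n) := by gcongr
    _ = (K + γ ^ b * C * (a + 2) ^ k) * (2 ^ (d + 1)) ^ (k + 2) *
        (((φ.n : ℝ) + 1) ^ ((d + 1) * (k + 2)) * γ ^ φ.n) := by
        rw [mul_pow, ← pow_mul ((φ.n : ℝ) + 1)]
        ring
    _ ≤ (K + γ ^ b * C * (a + 2) ^ k) * (2 ^ (d + 1)) ^ (k + 2) * (B * γ' ^ φ.n) :=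
        mul_le_mul_of_nonneg_left (hpoly φ.n) (by positivity)
    _ = _ := by ring

theorem mainTheorem6 (q : ℕ) (hq : 2 ≤ q) (ε : ℝ) (hε : 0 < ε) :
    ∃ r : ℕ, 2 ≤ r ∧ (SharpSETH → ¬ SharpCSPSolvable q r ((q : ℝ) - ε)) := by
  by_contra! h
  have hSETH : SharpSETH := (h 2 le_rfl).1
  have hq₂ : (2 : ℝ) ≤ q := by exact_mod_cast hq
  -- The base is raised to at least `1`, so that its powers increase with the exponent.
  obtain ⟨a, b, γ, ha, hb, hab, hγ₁, hγ₂, hβγ⟩ := exists_block_sizes hq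
    (le_max_right ((q : ℝ) - ε) 1) (max_lt (by linarith) (by linarith))
  obtain ⟨γ', hγγ', hγ'₂⟩ := exists_between hγ₂
  obtain ⟨d, hd, hSAT⟩ := hSETH (2 - γ') (by linarith)
  refine hSAT ?_
  rw [sub_sub_cancel]
  exact CNF.solvableInTime_of_sharpCSPSolvable (r := d * a + 2) hq ha hb hab
    ((Nat.le_mul_of_pos_left a hd).trans (by omega)) (by omega) hd (le_max_left _ _)
    (le_max_right _ _) hγ₁ hβγ hγγ' (h _ (by omega)).2
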